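/- Let $F$ be a field of characteristic zero, let $L$ be an $F$-vector space with a countably infinite basis $e_1,e_2,\dots$, and let $E$ be the Grassmann (exterior) algebra of $L$. Let $m<n$ be integers. Split the basis $\{e_1,e_2,\dots\}$ into two disjoint infinite sets, give each generator in the first set degree $m$ and each generator in the second set degree $n$, and let $E_{(m,n)}^{(\infty,\infty)}=\bigoplus_{r\in\mathbb Z}A_r$ be the resulting $\mathbb Z$-grading on $E$: $A_r$ is the span of the basic monomials $e_{i_1}\cdots e_{i_k}$ ($i_1<\dots<i_k$, $k\ge 0$) whose generators have degrees adding up to $r$. Assume that the grading has full support, i.e. $A_r\neq 0$ for every $r\in\mathbb Z$. Let $c_+$ be the minimum of $\alpha+\beta$ over all integers $\alpha,\beta\ge 0$ with $\alpha m+\beta n=1$, and let $c_-$ be the minimum of $\alpha'+\beta'$ over all integers $\alpha',\beta'\ge 0$ with $\alpha' m+\beta' n=-1$. Assume that either $c_+$ is even and $c_-$ is odd (type (2)), or $c_+$ is odd and $c_-$ is even (type (3)). Let $F\langle X|\mathbb Z\rangle$ be the free associative unitary $F$-algebra on variables $x_i^d$ of degree $d$ ($d\in\mathbb Z$, countably many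 for each $d$), with its natural $\mathbb Z$-grading. Let $T_{\mathbb Z}(E_{(m,n)}^{(\infty,\infty)})$ be the ideal of $\mathbb Z$-graded polynomial identities of $E_{(m,n)}^{(\infty,\infty)}$, i.e. of all polynomials in $F\langle X|\mathbb Z\rangle$ that vanish whenever each variable $x_i^d$ is replaced by an element of $A_d$. Let $\mathfrak V_1^{\mathbb Z}$ be the variety of $\mathbb Z$-graded algebras defined by the identities $[x_1,x_2,x_3]=[[x_1,x_2],x_3]$, for all degrees of the variables $x_1,x_2,x_3$; its ideal $T_{\mathbb Z}(\mathfrak V_1^{\mathbb Z})$ is the smallest two-sided ideal of $F\langle X|\mathbb Z\rangle$ that contains these polynomials and is invariant under all graded endomorphisms of $F\langle X|\mathbb Z\rangle$. Then $E_{(m,n)}^{(\infty,\infty)}$ generates the variety $\mathfrak V_1^{\mathbb Z}$, i.e. $T_{\mathbb Z}(E_{(m,n)}^{(\infty,\infty)})=T_{\mathbb Z}(\mathfrak V_1^{\mathbb Z})$. -/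

import Mathlib

open scoped DirectSum

/-! ### The free graded algebra, graded identities and varieties -/

/-- `F⟨X | ℤ⟩`: the free associative unitary `F`-algebra on the variables `x_i^d`, where the
variable `x_i^d` is indexed by the pair `(d, i)`. -/
abbrev FreeGraded (F : Type*) [Field F] := FreeAlgebra F (ℤ × ℕ)

/-- The variable `x_i^d`, of `ℤ`-degree `d`. -/
def gradedVar (F : Type*) [Field F] (d : ℤ) (i : ℕ) : FreeGraded F := FreeAlgebra.ι F (d, i)

/-- The homogeneous component of degree `d` of `F⟨X | ℤ⟩`: the span of all monomials whose
variables have degrees adding up to `d`. -/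
def freeComponent (F : Type*) [Field F] (d : ℤ) : Submodule F (FreeGraded F) :=
  Submodule.span F {p | ∃ w : List (ℤ × ℕ), (w.map Prod.fst).sum = d ∧
    p = (w.map fun v => gradedVar F v.1 v.2).prod}

/-- A `ℤ`-graded endomorphism of `F⟨X | ℤ⟩`. -/
def IsGradedEndo {F : Type*} [Field F] (φ : FreeGraded F →ₐ[F] FreeGraded F) : Prop :=
  ∀ d : ℤ, ∀ p ∈ freeComponent F d, φ p ∈ freeComponent F d

/-- A `T_ℤ`-ideal: a two-sided ideal of `F⟨X | ℤ⟩` that is invariant under all graded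
endomorphisms. -/
def IsTIdeal {F : Type*} [Field F] (I : TwoSidedIdeal (FreeGraded F)) : Prop :=
  ∀ φ : FreeGraded F →ₐ[F] FreeGraded F, IsGradedEndo φ → ∀ p ∈ I, φ p ∈ I

/-- The `T_ℤ`-ideal generated by a set of graded polynomials. -/
def tIdealSpan {F : Type*} [Field F] (s : Set (FreeGraded F)) : TwoSidedIdeal (FreeGraded F) :=
  sInf {I | IsTIdeal I ∧ s ⊆ {p | p ∈ I}}

theorem isTIdeal_tIdealSpan {F : Type*} [Field F] (s : Set (FreeGraded F)) :
    IsTIdeal (tIdealSpan s) := by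
  intro φ hφ p hp
  rw [tIdealSpan, TwoSidedIdeal.mem_sInf] at hp ⊢
  exact fun I hI => hI.1 φ hφ p (hp I hI)

/-- `T_ℤ(A)`: the ideal of all `ℤ`-graded polynomial identities of a `ℤ`-graded algebra
`A = ⨁ d, 𝒜 d`, that is, of all polynomials vanishing under every substitution of the variables
by elements of the components of the same degree. -/
def gradedIdentities {F A : Type*} [Field F] [Ring A] [Algebra F A] (𝒜 : ℤ → Submodule F A)
    [GradedAlgebra 𝒜] : TwoSidedIdeal (FreeGraded F) :=
  .mk' {p | ∀ a : ℤ × ℕ → A, (∀ v, a v ∈ 𝒜 v.1) → FreeAlgebra.lift F a p = 0}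
    (fun a _ => map_zero _)
    (fun hp hq a ha => by rw [map_add, hp a ha, hq a ha, add_zero])
    (fun hp a ha => by rw [map_neg, hp a ha, neg_zero])
    (fun hq a ha => by rw [map_mul, hq a ha, mul_zero])
    (fun hp a ha => by rw [map_mul, hp a ha, zero_mul])

/-- A variety of `ℤ`-graded `F`-algebras, given by its `T_ℤ`-ideal. -/
structure GradedVariety (F : Type*) [Field F] where
  /-- the `T_ℤ`-ideal of the variety -/
  tIdeal : TwoSidedIdeal (FreeGraded F)
  isTIdeal : IsTIdeal tIdeal

/-- A `ℤ`-graded algebra belongs to the variety if it satisfies all graded identities in the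
`T_ℤ`-ideal of the variety. -/
def GradedVariety.Mem {F A : Type*} [Field F] [Ring A] [Algebra F A] (V : GradedVariety F)
    (𝒜 : ℤ → Submodule F A) [GradedAlgebra 𝒜] : Prop :=
  V.tIdeal ≤ gradedIdentities 𝒜

/-- A `ℤ`-graded algebra generates the variety if its graded identities are exactly the elements of
the `T_ℤ`-ideal of the variety. -/
def GradedVariety.IsGeneratedBy {F A : Type*} [Field F] [Ring A] [Algebra F A]
    (V : GradedVariety F) (𝒜 : ℤ → Submodule F A) [GradedAlgebra 𝒜] : Prop :=
  V.tIdeal = gradedIdentities 𝒜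

/-- The variety `𝔙₁` of `ℤ`-graded algebras defined by the identities
`[x₁, x₂, x₃] = [[x₁, x₂], x₃]`, for all degrees of `x₁`, `x₂`, `x₃`. -/
def varietyOne (F : Type*) [Field F] : GradedVariety F where
  tIdeal := tIdealSpan {p | ∃ a b c : ℤ,
    p = ⁅⁅gradedVar F a 1, gradedVar F b 2⁆, gradedVar F c 3⁆}
  isTIdeal := isTIdeal_tIdealSpan _

/-! ### Gradings on the Grassmann algebra -/

/-- Given a basis `e` of `L` and a degree `δ i` for each generator `e i`, the component of degree
`r` of the Grassmann algebra of `L`: the span of the basic monomials `e_{i_1} ⋯ e_{i_k}`,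
`i_1 < ⋯ < i_k`, with `δ i_1 + ⋯ + δ i_k = r`. -/
noncomputable def grassmannComponent {F L : Type*} [Field F] [AddCommGroup L] [Module F L]
    (e : Module.Basis ℕ F L) (δ : ℕ → ℤ) (r : ℤ) : Submodule F (ExteriorAlgebra F L) :=
  Submodule.span F {w | ∃ s : Finset ℕ, ∑ i ∈ s, δ i = r ∧ w = e.ExteriorAlgebra s}

theorem grassmann_basis_mem {F L : Type*} [Field F] [AddCommGroup L] [Module F L]
    (e : Module.Basis ℕ F L) (δ : ℕ → ℤ) (s : Finset ℕ) :
    e.ExteriorAlgebra s ∈ grassmannComponent e δ (∑ i ∈ s, δ i) :=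
  Submodule.subset_span ⟨s, rfl, rfl⟩

instance grassmannComponent_gradedMonoid {F L : Type*} [Field F] [AddCommGroup L] [Module F L]
    (e : Module.Basis ℕ F L) (δ : ℕ → ℤ) : SetLike.GradedMonoid (grassmannComponent e δ) where
  one_mem := by
    have h := grassmann_basis_mem e δ ∅
    rw [ExteriorAlgebra.basis_apply_ofCard e (n := 0) rfl] at h
    simpa [exteriorPower.ιMulti_family, ExteriorAlgebra.ιMulti_family] using h
  mul_mem := by
    intro i j x y hx hy
    have h : x * y ∈ grassmannComponent e δ i * grassmannComponent e δ j :=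
      Submodule.mul_mem_mul hx hy
    refine (?_ : grassmannComponent e δ i * grassmannComponent e δ j ≤ _) h
    conv_lhs => rw [grassmannComponent, grassmannComponent, Submodule.span_mul_span]
    rw [Submodule.span_le]
    rintro _ ⟨_, ⟨s, rfl, rfl⟩, _, ⟨t, rfl, rfl⟩, rfl⟩
    let s' : Set.powersetCard ℕ s.card := Set.powersetCard.ofCard rfl
    let t' : Set.powersetCard ℕ t.card := Set.powersetCard.ofCard rfl
    change e.ExteriorAlgebra s'.val * e.ExteriorAlgebra t'.val ∈ _
    by_cases hd : Disjoint s'.val t'.val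
    · rw [ExteriorAlgebra.basis_mul_of_disjoint e s' t' hd]
      have h' := grassmann_basis_mem e δ (Set.powersetCard.disjUnion hd).val
      rw [Set.powersetCard.coe_disjUnion, Finset.sum_disjUnion] at h'
      rw [Units.smul_def]
      exact zsmul_mem h' _
    · rw [ExteriorAlgebra.basis_mul_of_not_disjoint e s' t' hd]
      exact Submodule.zero_mem _

/-- The components of the Grassmann algebra attached to a choice of degrees of the generators form
a `ℤ`-grading. -/
noncomputable instance grassmannGrading {F L : Type*} [Field F] [AddCommGroup L] [Module F L]
    (e : Module.Basis ℕ F L) (δ : ℕ → ℤ) : GradedAlgebra (grassmannComponent e δ) where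
  toGradedMonoid := grassmannComponent_gradedMonoid e δ
  toDecomposition := .ofLinearMap (grassmannComponent e δ)
    (e.ExteriorAlgebra.constr F fun s =>
      DirectSum.lof F ℤ (fun r => grassmannComponent e δ r) (∑ i ∈ s, δ i)
        ⟨e.ExteriorAlgebra s, grassmann_basis_mem e δ s⟩)
    (by
      refine e.ExteriorAlgebra.ext fun s => ?_
      simp [Module.Basis.constr_basis])
    (by
      ext r ⟨x, hx⟩ : 2
      simp only [LinearMap.comp_apply, DirectSum.coeLinearMap_lof, LinearMap.id_apply]
      induction hx using Submodule.span_induction with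
      | mem w hw =>
        obtain ⟨s, rfl, rfl⟩ := hw
        rw [Module.Basis.constr_basis]
      | zero => rw [map_zero]; exact (map_zero _).symm
      | add x y hx hy ihx ihy => rw [map_add, ihx, ihy, ← map_add]; rfl
      | smul c x hx ihx => rw [map_smul, ihx, ← map_smul]; rfl)

open Classical in
/-- The degrees of the generators in a `2`-induced grading with lower indexes `m`, `n`: the
generators are split into those indexed by `S`, of degree `m`, and the others, of degree `n`. -/
noncomputable def twoInducedDegree (m n : ℤ) (S : Set ℕ) (i : ℕ) : ℤ := if i ∈ S then m else n

/-- The `2`-induced `ℤ`-grading on the Grassmann algebra of `L` for which the generators `e i` with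
`i ∈ S` have degree `m` and the generators `e i` with `i ∉ S` have degree `n`. It is
`E_{(m, n)}^{(∞, ∞)}` when both `S` and its complement are infinite. -/
noncomputable abbrev twoInduced {F L : Type*} [Field F] [AddCommGroup L] [Module F L]
    (e : Module.Basis ℕ F L) (m n : ℤ) (S : Set ℕ) : ℤ → Submodule F (ExteriorAlgebra F L) :=
  grassmannComponent e (twoInducedDegree m n S)

/-- The support of a `ℤ`-grading. -/
def gradingSupport {F A : Type*} [Field F] [Ring A] [Algebra F A] (𝒜 : ℤ → Submodule F A)
    [GradedAlgebra 𝒜] : Set ℤ :=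
  {r | 𝒜 r ≠ ⊥}

/-- `k` is the minimal value of `α + β` over all `α, β ∈ {0, 1, 2, …}` with `α m + β n = t`. -/
def IsCoefficient (m n t : ℤ) (k : ℕ) : Prop :=
  IsLeast {j : ℕ | ∃ α β : ℕ, (α : ℤ) * m + (β : ℤ) * n = t ∧ α + β = j} k

/-- Type (2): the coefficient for `1` is even and the coefficient for `-1` is odd. -/
def IsTypeTwo (m n : ℤ) : Prop :=
  ∃ k k' : ℕ, IsCoefficient m n 1 k ∧ IsCoefficient m n (-1) k' ∧ Even k ∧ Odd k'

/-- Type (3): the coefficient for `1` is odd and the coefficient for `-1` is even. -/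
def IsTypeThree (m n : ℤ) : Prop :=
  ∃ k k' : ℕ, IsCoefficient m n 1 k ∧ IsCoefficient m n (-1) k' ∧ Odd k ∧ Even k'

/-! Both ideals are compared through one family of normal forms: an ordered monomial times a product
of commutators `[x_{j_1}, x_{j_2}]⋯` in distinct variables, so that only a multiset `a` and an even
set `J` of variables matter.

Modulo central commutators these forms span. Reordering a word costs central commutators times
shorter words, and the product of commutators is alternating in all its entries jointly
(`exists_normalForm`).

On the Grassmann algebra they are independent (`eq_zero_of_forall_sum_eq_zero`). The minimal
representations of `1` and `-1` have lengths of opposite parity, so together they give degree `0`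
with an odd number of generators. Hence every degree contains infinitely many disjoint monomials of
each parity. A variable can then be replaced by `z + θ`, with `z` a sum of even (central) monomials
and `θ` odd or zero: commutators see only `θ`, and the powers of `z` detect multiplicities. Choosing
the sizes to match a minimal `J` and then a minimal `a` isolates one coefficient, up to a nonzero
integer because the characteristic is zero.

Since the Grassmann algebra itself has central commutators, one inclusion is immediate; independence
turns the spanning statement into the other. -/

/-! ### Rings with central commutators -/

/-- The commutators of a ring are central: the identity `[p, q, r] = 0`. -/
def HasCentralCommutators (R : Type*) [Ring R] : Prop := ∀ p q r : R, ⁅⁅p, q⁆, r⁆ = 0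

theorem HasCentralCommutators.lie_mul_comm {R : Type*} [Ring R] (h : HasCentralCommutators R)
    (p q r : R) : ⁅p, q⁆ * r = r * ⁅p, q⁆ := by
  have := h p q r
  rwa [Ring.lie_def ⁅p, q⁆ r, sub_eq_zero] at this

/-- Expanding `[[ab, c], d]` by the Leibniz rule leaves only the cross terms, the other double
commutators being zero. -/
theorem HasCentralCommutators.lie_mul_lie_add {R : Type*} [Ring R] (h : HasCentralCommutators R)
    (a b c d : R) : ⁅a, c⁆ * ⁅b, d⁆ + ⁅a, d⁆ * ⁅b, c⁆ = 0 := by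
  have h1 := h (a * b) c d
  have h2 : ⁅⁅a * b, c⁆, d⁆ = ⁅a, c⁆ * ⁅b, d⁆ + ⁅a, d⁆ * ⁅b, c⁆ + a * ⁅⁅b, c⁆, d⁆
      + ⁅⁅a, c⁆, d⁆ * b := by
    simp only [Ring.lie_def]; noncomm_ring
  rw [h b c d, h a c d, h1] at h2
  simpa using h2.symm

theorem HasCentralCommutators.lie_mul_lie_swap {R : Type*} [Ring R] (h : HasCentralCommutators R)
    (p q r s : R) : ⁅p, q⁆ * ⁅r, s⁆ = -(⁅p, r⁆ * ⁅q, s⁆) := by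
  have h1 := h.lie_mul_lie_add p r q s
  have h2 := h.lie_mul_lie_add p q s r
  have h3 : ⁅r, q⁆ = -⁅q, r⁆ := by simp only [Ring.lie_def]; noncomm_ring
  rw [h3, mul_neg] at h1
  rw [eq_neg_of_add_eq_zero_left h1, neg_neg, eq_neg_of_add_eq_zero_left h2]

/-- The product `[x₁, x₂][x₃, x₄]⋯` of the commutators of consecutive members of a list, which is
zero for lists of odd length. -/
def commProd {R V : Type*} [Ring R] (x : V → R) : List V → R
  | [] => 1
  | [_] => 0
  | u :: v :: l => ⁅x u, x v⁆ * commProd x l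

/-- The product of the members of a multiset, in an order chosen once and for all. -/
noncomputable def orderedMonomial {R V : Type*} [Ring R] (x : V → R) (a : Multiset V) : R :=
  (a.toList.map x).prod

/-! ### Spanning: reduction to normal forms when commutators are central. -/

section commProd

variable {R V : Type*} [Ring R] (x : V → R)

theorem map_commProd {R' : Type*} [Ring R'] (f : R →+* R') :
    ∀ l : List V, f (commProd x l) = commProd (fun v => f (x v)) l
  | [] => by simp [commProd]
  | [_] => by simp [commProd]
  | u :: v :: l => by simp [commProd, map_commProd f l, Ring.lie_def]

theorem map_orderedMonomial {R' : Type*} [Ring R'] (f : R →+* R') (a : Multiset V) :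
    f (orderedMonomial x a) = orderedMonomial (fun v => f (x v)) a := by
  simp [orderedMonomial, map_list_prod, Function.comp_def]

theorem commProd_of_odd : ∀ l : List V, Odd l.length → commProd x l = 0
  | [], h => by simp at h
  | [_], _ => rfl
  | u :: v :: l, h => by
    have : Odd l.length := by
      simp only [List.length_cons] at h
      rw [Nat.odd_iff] at h ⊢; omega
    simp [commProd, commProd_of_odd l this]

theorem commProd_append : ∀ l l' : List V, Even l.length →
    commProd x (l ++ l') = commProd x l * commProd x l'
  | [], l', _ => by simp [commProd]
  | [_], l', h => by simp at h
  | u :: v :: l, l', h => by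
    have : Even l.length := by
      simp only [List.length_cons] at h
      rw [Nat.even_iff] at h ⊢; omega
    simp [commProd, commProd_append l l' this, mul_assoc]

variable (h : HasCentralCommutators R)
include h

/-- Inside one commutator this is antisymmetry; across two neighbouring commutators it is
`lie_mul_lie_swap`. Removing two prefix entries at a time preserves the pairing and reduces to these
cases. -/
theorem commProd_swap (u v : V) (l : List V) :
    ∀ p : List V, commProd x (p ++ u :: v :: l) = -commProd x (p ++ v :: u :: l)
  | [] => by
    simp only [List.nil_append, commProd, ← neg_mul]
    congr 1
    simp only [Ring.lie_def]; noncomm_ring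
  | [a] => by
    cases l with
    | nil => simp [commProd]
    | cons b l =>
      simp only [List.cons_append, List.nil_append, commProd, ← mul_assoc, ← neg_mul]
      rw [h.lie_mul_lie_swap, neg_mul, neg_mul, neg_mul]
  | a :: b :: p => by
    simp only [List.cons_append, commProd]
    rw [commProd_swap u v l p, mul_neg]

/-- The prefix `p` is what makes the induction run: a common head shifts the pairing of the entries,
so it has to be absorbed into `p`. -/
theorem commProd_perm {l l' : List V} (hl : l.Perm l') : ∀ p : List V,
    commProd x (p ++ l) = commProd x (p ++ l') ∨ commProd x (p ++ l) = -commProd x (p ++ l') := by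
  induction hl with
  | nil => exact fun p => Or.inl rfl
  | cons a _ ih => intro p; simpa using ih (p ++ [a])
  | swap a b l => exact fun p => Or.inr (commProd_swap x h b a l p)
  | trans _ _ ih ih' =>
    intro p
    rcases ih p with h1 | h1 <;> rcases ih' p with h2 | h2 <;> rw [h1, h2] <;> simp

/-- The two equal entries can be brought to the front, where they form `[a, a] = 0`; no division by
`2` is needed. -/
theorem commProd_of_not_nodup {l : List V} (hl : ¬ l.Nodup) : commProd x l = 0 := by
  obtain ⟨a, ha⟩ := List.exists_duplicate_iff_not_nodup.mpr hl
  obtain ⟨l', hl'⟩ := (List.duplicate_iff_sublist.mp ha).exists_perm_append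
  have h0 : commProd x ([a, a] ++ l') = 0 := by
    simp [commProd, Ring.lie_def]
  rcases commProd_perm x h hl' [] with h1 | h1 <;>
    simpa only [List.nil_append, h0, neg_zero] using h1

theorem commProd_mem_span [DecidableEq V] {F : Type*} [CommRing F] [Algebra F R] (l : List V) :
    commProd x l ∈ Submodule.span F
      (Set.range fun J : {J : Finset V // Even J.card} => commProd x J.1.toList) := by
  rcases Nat.even_or_odd l.length with he | ho
  · by_cases hl : l.Nodup
    · have hp : l.Perm l.toFinset.toList := by
        rw [← Multiset.coe_eq_coe, Finset.coe_toList, List.toFinset_val, hl.dedup]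
      have hm : commProd x l.toFinset.toList ∈ Submodule.span F
          (Set.range fun J : {J : Finset V // Even J.card} => commProd x J.1.toList) :=
        Submodule.subset_span ⟨⟨l.toFinset, by rwa [List.toFinset_card_of_nodup hl]⟩, rfl⟩
      rcases commProd_perm x h hp [] with h1 | h1
      · simp only [List.nil_append] at h1
        rwa [h1]
      · simp only [List.nil_append] at h1
        rw [h1]
        exact Submodule.neg_mem _ hm
    · rw [commProd_of_not_nodup x h hl]; exact Submodule.zero_mem _
  · rw [commProd_of_odd x l ho]; exact Submodule.zero_mem _

variable (F : Type*) [CommRing F] [Algebra F R]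

/-- Permuting the factors of a word changes it by shorter words times commutators. -/
theorem word_sub_word_mem_span {w w' : List V} (hw : w.Perm w') :
    (w.map x).prod - (w'.map x).prod ∈ Submodule.span F
      {r | ∃ u l : List V, u.length < w.length ∧ Even l.length ∧
        r = (u.map x).prod * commProd x l} := by
  induction hw with
  | nil => simp
  | @cons a w w' _ ih =>
    rw [List.map_cons, List.map_cons, List.prod_cons, List.prod_cons, ← mul_sub]
    refine Submodule.span_induction
      (p := fun r _ => x a * r ∈ Submodule.span F
        {r | ∃ u l : List V, u.length < (a :: w).length ∧ Even l.length ∧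
          r = (u.map x).prod * commProd x l}) ?_ (by simp) ?_ ?_ ih
    · rintro _ ⟨u, l, hu, hl, rfl⟩
      exact Submodule.subset_span ⟨a :: u, l, by simpa using hu, hl, by simp [mul_assoc]⟩
    · intro p q _ _ hp hq
      rw [mul_add]; exact Submodule.add_mem _ hp hq
    · intro c p _ hp
      rw [mul_smul_comm]; exact Submodule.smul_mem _ _ hp
  | swap a b w =>
    -- The difference is `[b, a]` times `w`; centrality moves the commutator to the right of the
    -- shorter word.
    refine Submodule.subset_span ⟨w, [b, a], by simp, by simp, ?_⟩
    simp only [commProd, mul_one]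
    rw [← h.lie_mul_comm]
    simp only [List.map_cons, List.prod_cons, Ring.lie_def]
    noncomm_ring
  | trans h1 _ ih ih' =>
    rw [← h1.length_eq] at ih'
    simpa using Submodule.add_mem _ ih ih'

/-- Strong induction on the length of the word: sorting it produces shorter words, whose extra
commutators are merged into `commProd x l`. -/
theorem word_mul_commProd_mem_span [DecidableEq V] (n : ℕ) : ∀ w l : List V, w.length = n →
    (w.map x).prod * commProd x l ∈ Submodule.span F
      (Set.range fun p : Multiset V × {J : Finset V // Even J.card} =>
        orderedMonomial x p.1 * commProd x p.2.1.toList) := by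
  induction n using Nat.strong_induction_on with
  | _ n ih =>
    intro w l hw
    have hp : w.Perm (w : Multiset V).toList := by
      rw [← Multiset.coe_eq_coe, Multiset.coe_toList]
    have h1 := word_sub_word_mem_span x h F hp
    rw [← sub_add_cancel (w.map x).prod (((w : Multiset V).toList.map x).prod), add_mul]
    refine Submodule.add_mem _ ?_ ?_
    · refine Submodule.span_induction
        (p := fun r _ => r * commProd x l ∈ Submodule.span F
          (Set.range fun p : Multiset V × {J : Finset V // Even J.card} =>
            orderedMonomial x p.1 * commProd x p.2.1.toList)) ?_ (by simp) ?_ ?_ h1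
      · rintro _ ⟨u, l', hu, hl', rfl⟩
        rw [mul_assoc, ← commProd_append x _ _ hl']
        exact ih _ (hw ▸ hu) u _ rfl
      · intro p q _ _ hp hq
        rw [add_mul]; exact Submodule.add_mem _ hp hq
      · intro c p _ hp
        rw [smul_mul_assoc]; exact Submodule.smul_mem _ _ hp
    · refine Submodule.span_induction
        (p := fun r _ => ((w : Multiset V).toList.map x).prod * r ∈ Submodule.span F
          (Set.range fun p : Multiset V × {J : Finset V // Even J.card} =>
            orderedMonomial x p.1 * commProd x p.2.1.toList)) ?_ (by simp) ?_ ?_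
          (commProd_mem_span x h (F := F) l)
      · rintro _ ⟨J, rfl⟩
        exact Submodule.subset_span ⟨(w, J), rfl⟩
      · intro p q _ _ hp hq
        rw [mul_add]; exact Submodule.add_mem _ hp hq
      · intro c p _ hp
        rw [mul_smul_comm]; exact Submodule.smul_mem _ _ hp

end commProd

/-! ### Evaluation on a central element plus an anticommuting element -/

section Evaluation

variable {R V : Type*} [Ring R] {z : V → Subring.center R} {θ : V → R}

/-- The central parts drop out of each commutator, and anticommutation gives `[θ u, θ v] = 2 θ u θ
v`. -/
theorem commProd_central_add (hθ : ∀ u v, θ u * θ v = -(θ v * θ u)) :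
    ∀ l : List V, Even l.length →
      ∃ k : ℕ, commProd (fun v => (z v : R) + θ v) l = 2 ^ k * (l.map θ).prod
  | [], _ => ⟨0, by simp [commProd]⟩
  | [_], h => by simp at h
  | u :: v :: l, h => by
    have hl : Even l.length := by
      simp only [List.length_cons] at h
      rw [Nat.even_iff] at h ⊢; omega
    obtain ⟨k, hk⟩ := commProd_central_add hθ l hl
    refine ⟨k + 1, ?_⟩
    have hu := Subring.mem_center_iff.mp (z u).2
    have hv := Subring.mem_center_iff.mp (z v).2
    have h1 : ⁅(z u : R) + θ u, (z v : R) + θ v⁆ = 2 * (θ u * θ v) := by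
      rw [Ring.lie_def, add_mul, mul_add, mul_add, add_mul, mul_add, mul_add, hθ v u, hu (θ v),
        ← hv (θ u), hv (z u : R)]
      noncomm_ring
    have h2 : Commute (θ u * θ v) ((2 : R) ^ k) := ((Commute.ofNat_right _ 2).pow_right k)
    rw [commProd, h1, hk, List.map_cons, List.map_cons, List.prod_cons, List.prod_cons, pow_succ',
      mul_assoc, ← mul_assoc (θ u * θ v), h2.eq]
    simp only [mul_assoc]

/-- In front of `Θ` each factor `z v + θ v` acts as `z v`: its odd part passes the central factors
and is killed by `Θ`. -/
theorem orderedMonomial_central_add_mul {Θ : R} (hΘ : ∀ v, θ v * Θ = 0) (a : Multiset V) :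
    orderedMonomial (fun v => (z v : R) + θ v) a * Θ = ((a.map z).prod : Subring.center R) * Θ := by
  conv_rhs => rw [← Multiset.coe_toList a, Multiset.map_coe, Multiset.prod_coe]
  rw [orderedMonomial]
  induction a.toList with
  | nil => simp
  | cons v l ih =>
    have hl := Subring.mem_center_iff.mp ((l.map z).prod).2 (θ v)
    rw [List.map_cons, List.prod_cons, mul_assoc, ih, add_mul, ← mul_assoc (θ v), hl, mul_assoc,
      hΘ, mul_zero, add_zero, List.map_cons, List.prod_cons, Subring.coe_mul, mul_assoc]

theorem mul_list_prod_eq_zero_of_mem (hθ : ∀ u v, θ u * θ v = -(θ v * θ u))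
    (hsq : ∀ v, θ v * θ v = 0) {v : V} : ∀ {l : List V}, v ∈ l → θ v * (l.map θ).prod = 0
  | u :: l, h => by
    rw [List.map_cons, List.prod_cons, ← mul_assoc]
    rcases List.mem_cons.mp h with rfl | h
    · rw [hsq, zero_mul]
    · rw [hθ, neg_mul, mul_assoc, mul_list_prod_eq_zero_of_mem hθ hsq h, mul_zero, neg_zero]

end Evaluation

/-! ### Powers of sums of square-zero elements. -/

section SquareZero

variable {C : Type*} [CommRing C]

theorem add_pow_succ_of_mul_self_eq_zero {z u : C} (hu : u * u = 0) (k : ℕ) :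
    (z + u) ^ (k + 1) = z ^ (k + 1) + (k + 1) * z ^ k * u := by
  induction k with
  | zero => simp
  | succ k ih =>
    rw [pow_succ, ih]
    push_cast
    linear_combination ((k : C) + 1) * z ^ k * hu

/-- Only squarefree terms of the multinomial expansion survive. Thus a sum of `N` such elements
detects exponents: exponent `N` gives the full product, larger ones give zero. -/
theorem sum_range_pow_of_mul_self_eq_zero {u : ℕ → C} (hu : ∀ k, u k * u k = 0) (N : ℕ) :
    (∑ k ∈ Finset.range N, u k) ^ (N + 1) = 0 ∧
      (∑ k ∈ Finset.range N, u k) ^ N = N.factorial * ∏ k ∈ Finset.range N, u k := by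
  induction N with
  | zero => simp
  | succ N ih =>
    rw [Finset.sum_range_succ, Finset.prod_range_succ, add_pow_succ_of_mul_self_eq_zero (hu N),
      add_pow_succ_of_mul_self_eq_zero (hu N), pow_succ, ih.1, ih.2, Nat.factorial_succ]
    push_cast
    exact ⟨by ring, by ring⟩

end SquareZero

/-! ### The Grassmann algebra -/

section Grassmann

variable {F L : Type*} [Field F] [AddCommGroup L] [Module F L]

namespace ExteriorAlgebra

theorem prod_map_ι_mul_ι (l : List L) (x : L) :
    (l.map (ι F)).prod * ι F x = (-1) ^ l.length * (ι F x * (l.map (ι F)).prod) := by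
  induction l with
  | nil => simp
  | cons a l ih =>
    have h : ι F a * ι F x = -(ι F x * ι F a) :=
      eq_neg_of_add_eq_zero_left (ι_add_mul_swap a x)
    have h2 : Commute (ι F a) ((-1 : ExteriorAlgebra F L) ^ l.length) :=
      ((Commute.neg_one_right _).pow_right _)
    rw [List.map_cons, List.prod_cons, mul_assoc, ih, ← mul_assoc, h2.eq, mul_assoc,
      ← mul_assoc (ι F a), h, List.length_cons, pow_succ]
    simp only [mul_assoc, neg_mul, mul_neg, mul_one]

theorem prod_map_ι_mul_prod_map_ι (l l' : List L) :
    (l.map (ι F)).prod * (l'.map (ι F)).prod =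
      (-1) ^ (l.length * l'.length) * ((l'.map (ι F)).prod * (l.map (ι F)).prod) := by
  induction l' with
  | nil => simp
  | cons a l' ih =>
    have h2 : Commute (ι F a) ((-1 : ExteriorAlgebra F L) ^ (l.length * l'.length)) :=
      ((Commute.neg_one_right _).pow_right _)
    rw [List.map_cons, List.prod_cons, ← mul_assoc, prod_map_ι_mul_ι, mul_assoc, mul_assoc, ih,
      ← mul_assoc (ι F a), h2.eq, List.length_cons, mul_add, mul_one, add_comm, pow_add]
    simp only [mul_assoc]

variable {I : Type*} [LinearOrder I] (e : Module.Basis I F L)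

theorem exists_list_basis_eq (s : Finset I) :
    ∃ l : List L, l.length = s.card ∧ e.ExteriorAlgebra s = (l.map (ι F)).prod := by
  refine ⟨List.ofFn (e ∘ Set.powersetCard.ofFinEmbEquiv.symm (Set.powersetCard.ofCard rfl)),
    List.length_ofFn, ?_⟩
  rw [basis_apply_ofCard e (n := s.card) rfl, ιMulti_family, ιMulti_apply, List.map_ofFn]
  rfl

theorem basis_mul_comm (s t : Finset I) :
    e.ExteriorAlgebra s * e.ExteriorAlgebra t =
      (-1) ^ (s.card * t.card) * (e.ExteriorAlgebra t * e.ExteriorAlgebra s) := by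
  obtain ⟨l, hl, h⟩ := exists_list_basis_eq e s
  obtain ⟨l', hl', h'⟩ := exists_list_basis_eq e t
  rw [h, h', ← hl, ← hl', prod_map_ι_mul_prod_map_ι]

theorem basis_mul_basis (s t : Finset I) (h : Disjoint s t) :
    ∃ ε : ℤˣ, e.ExteriorAlgebra s * e.ExteriorAlgebra t = ε • e.ExteriorAlgebra (s ∪ t) := by
  have hb := basis_mul_of_disjoint e (Set.powersetCard.ofCard (s := s) rfl)
    (Set.powersetCard.ofCard (s := t) rfl) h
  exact ⟨_, hb.trans (congrArg _ (congrArg _ (Finset.disjUnion_eq_union s t h)))⟩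

theorem basis_mul_self {s : Finset I} (h : s.Nonempty) :
    e.ExteriorAlgebra s * e.ExteriorAlgebra s = 0 :=
  basis_mul_of_not_disjoint e (Set.powersetCard.ofCard (s := s) rfl)
    (Set.powersetCard.ofCard (s := s) rfl) (by simpa [Finset.nonempty_iff_ne_empty] using h)

theorem basis_list_prod (l : List (Finset I)) (h : l.Pairwise Disjoint) :
    ∃ ε : ℤˣ, (l.map e.ExteriorAlgebra).prod = ε • e.ExteriorAlgebra (l.foldr (· ∪ ·) ∅) := by
  induction l with
  | nil =>
    refine ⟨1, ?_⟩
    rw [List.foldr_nil, one_smul, basis_apply_ofCard e (n := 0) rfl]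
    simp [ιMulti_family]
  | cons s l ih =>
    rw [List.pairwise_cons] at h
    obtain ⟨ε, hε⟩ := ih h.2
    have hd : Disjoint s (l.foldr (· ∪ ·) ∅) := by
      have := h.1
      clear hε ih h
      induction l with
      | nil => simp
      | cons t l ih =>
        rw [List.foldr_cons, Finset.disjoint_union_right]
        exact ⟨this t (by simp), ih fun u hu => this u (by simp [hu])⟩
    obtain ⟨ε', hε'⟩ := basis_mul_basis e s _ hd
    exact ⟨ε * ε', by
      rw [List.map_cons, List.prod_cons, hε, mul_smul_comm, hε', smul_smul, List.foldr_cons]⟩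

theorem basis_list_prod_ne_zero (l : List (Finset I)) (h : l.Pairwise Disjoint) :
    (l.map e.ExteriorAlgebra).prod ≠ 0 := by
  obtain ⟨ε, hε⟩ := basis_list_prod e l h
  rw [hε, ne_eq, smul_eq_zero_iff_eq]
  exact e.ExteriorAlgebra.ne_zero _

theorem basis_mem_center {s : Finset I} (h : Even s.card) :
    e.ExteriorAlgebra s ∈ Subring.center (ExteriorAlgebra F L) := by
  rw [Subring.mem_center_iff]
  intro g
  induction e.ExteriorAlgebra.mem_span g using Submodule.span_induction with
  | mem w hw =>
    obtain ⟨t, rfl⟩ := hw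
    rw [basis_mul_comm, (h.mul_left t.card).neg_one_pow, one_mul]
  | zero => simp
  | add p q _ _ hp hq => rw [add_mul, mul_add, hp, hq]
  | smul c p _ hp => rw [smul_mul_assoc, mul_smul_comm, hp]

theorem basis_anticomm {s t : Finset I} (hs : Odd s.card) (ht : Odd t.card) :
    e.ExteriorAlgebra s * e.ExteriorAlgebra t =
      -(e.ExteriorAlgebra t * e.ExteriorAlgebra s) := by
  rw [basis_mul_comm, (hs.mul ht).neg_one_pow, neg_one_mul]

/-- Only two odd monomials can fail to commute, and then their product is even or zero, hence
central. -/
theorem lie_basis_mem_center (s t : Finset I) :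
    ⁅e.ExteriorAlgebra s, e.ExteriorAlgebra t⁆ ∈ Subring.center (ExteriorAlgebra F L) := by
  rw [Ring.lie_def]
  rcases Nat.even_or_odd s.card with hs | hs
  · rw [Subring.mem_center_iff.mp (basis_mem_center e hs), sub_self]
    exact zero_mem _
  rcases Nat.even_or_odd t.card with ht | ht
  · rw [Subring.mem_center_iff.mp (basis_mem_center e ht), sub_self]
    exact zero_mem _
  rw [basis_anticomm e ht hs, sub_neg_eq_add]
  have : e.ExteriorAlgebra s * e.ExteriorAlgebra t ∈ Subring.center (ExteriorAlgebra F L) := by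
    by_cases hd : Disjoint s t
    · obtain ⟨ε, hε⟩ := basis_mul_basis e s t hd
      rw [hε, Units.smul_def]
      have hst : Even (s ∪ t).card := by
        rw [Finset.card_union_of_disjoint hd]; exact hs.add_odd ht
      exact zsmul_mem (basis_mem_center e hst) _
    · rw [show e.ExteriorAlgebra s * e.ExteriorAlgebra t = 0 from
        basis_mul_of_not_disjoint e (Set.powersetCard.ofCard (s := s) rfl)
          (Set.powersetCard.ofCard (s := t) rfl) hd]
      exact zero_mem _
  exact add_mem this this

include e in
theorem hasCentralCommutators : HasCentralCommutators (ExteriorAlgebra F L) := by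
  have key : ∀ p q : ExteriorAlgebra F L, ⁅p, q⁆ ∈ Subring.center (ExteriorAlgebra F L) := by
    have smul_mem : ∀ (c : F) (w : ExteriorAlgebra F L), w ∈ Subring.center (ExteriorAlgebra F L) →
        c • w ∈ Subring.center (ExteriorAlgebra F L) := fun c w hw => by
      rw [Subring.mem_center_iff] at hw ⊢
      intro g
      rw [mul_smul_comm, smul_mul_assoc, hw]
    intro p q
    induction e.ExteriorAlgebra.mem_span p using Submodule.span_induction with
    | mem w hw =>
      obtain ⟨s, rfl⟩ := hw
      induction e.ExteriorAlgebra.mem_span q using Submodule.span_induction with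
      | mem w hw =>
        obtain ⟨t, rfl⟩ := hw
        exact lie_basis_mem_center e s t
      | zero => rw [Ring.lie_def, mul_zero, zero_mul, sub_zero]; exact zero_mem _
      | add p q _ _ hp hq =>
        rw [Ring.lie_def, mul_add, add_mul, add_sub_add_comm]; exact add_mem hp hq
      | smul c p _ hp =>
        rw [Ring.lie_def, mul_smul_comm, smul_mul_assoc, ← smul_sub]; exact smul_mem c _ hp
    | zero => rw [Ring.lie_def, mul_zero, zero_mul, sub_zero]; exact zero_mem _
    | add p q _ _ hp hq =>
      rw [Ring.lie_def, mul_add, add_mul, add_sub_add_comm]; exact add_mem hp hq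
    | smul c p _ hp =>
      rw [Ring.lie_def, mul_smul_comm, smul_mul_assoc, ← smul_sub]; exact smul_mem c _ hp
  intro p q r
  rw [Ring.lie_def, Subring.mem_center_iff.mp (key p q) r, sub_self]

end ExteriorAlgebra

end Grassmann

/-! ### Disjoint monomials of given degree and parity -/

/-- Disjoint finite sets with prescribed properties can be chosen one after the other. -/
theorem exists_pairwise_disjoint_family {ι : Type*} [Encodable ι] (P : ι → Finset ℕ → Prop)
    (h : ∀ i T, ∃ s, Disjoint s T ∧ P i s) :
    ∃ g : ι → Finset ℕ, (∀ i, P i (g i)) ∧ Pairwise fun i j => Disjoint (g i) (g j) := by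
  have h' : ∀ (n : ℕ) (T : Finset ℕ), ∃ s, Disjoint s T ∧
      ∀ i, Encodable.encode i = n → P i s := by
    intro n T
    by_cases hn : ∃ i : ι, Encodable.encode i = n
    · obtain ⟨i, rfl⟩ := hn
      obtain ⟨s, hs, hP⟩ := h i T
      exact ⟨s, hs, fun j hj => Encodable.encode_injective hj ▸ hP⟩
    · exact ⟨∅, by simp, fun i hi => (hn ⟨i, hi⟩).elim⟩
  choose f hf hP using h'
  -- `T n` is the union of the sets chosen at stages before `n`; stage `n` must avoid it.
  let T : ℕ → Finset ℕ := fun n => Nat.rec ∅ (fun k U => U ∪ f k U) n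
  have hT : ∀ n, T (n + 1) = T n ∪ f n (T n) := fun _ => rfl
  have hmono : Monotone T := monotone_nat_of_le_succ fun n => by
    rw [hT]; exact Finset.subset_union_left
  have hlt : ∀ a b : ℕ, a < b → Disjoint (f b (T b)) (f a (T a)) := fun a b hab =>
    (hf b (T b)).mono_right
      (Finset.subset_union_right.trans ((hT a).symm.subset.trans (hmono hab)))
  refine ⟨fun i => f (Encodable.encode i) (T (Encodable.encode i)), fun i => hP _ _ i rfl, ?_⟩
  intro i j hij
  rcases lt_or_gt_of_ne (Encodable.encode_injective.ne hij) with hl | hl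
  · exact (hlt _ _ hl).symm
  · exact hlt _ _ hl

/-- Adding the representations of `1` and `-1` represents `0` with an odd number of summands; each
added copy keeps the degree and flips the parity. -/
theorem exists_nat_combination {m n : ℤ} (htype : IsTypeTwo m n ∨ IsTypeThree m n) (d : ℤ)
    (p : ℕ) : ∃ α β : ℕ, (α : ℤ) * m + (β : ℤ) * n = d ∧ 0 < α + β ∧ (α + β) % 2 = p % 2 := by
  obtain ⟨α, β, α', β', h1, h2, hodd⟩ : ∃ α β α' β' : ℕ, (α : ℤ) * m + (β : ℤ) * n = 1 ∧
      (α' : ℤ) * m + (β' : ℤ) * n = -1 ∧ (α + β + (α' + β')) % 2 = 1 := by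
    rcases htype with ⟨k, k', ⟨⟨α, β, h1, rfl⟩, _⟩, ⟨⟨α', β', h2, rfl⟩, _⟩, hk, hk'⟩ |
      ⟨k, k', ⟨⟨α, β, h1, rfl⟩, _⟩, ⟨⟨α', β', h2, rfl⟩, _⟩, hk, hk'⟩
    · exact ⟨α, β, α', β', h1, h2, Nat.odd_iff.mp (hk.add_odd hk')⟩
    · exact ⟨α, β, α', β', h1, h2, Nat.odd_iff.mp (hk.add_even hk')⟩
  obtain ⟨α₀, β₀, h0⟩ : ∃ α₀ β₀ : ℕ, (α₀ : ℤ) * m + (β₀ : ℤ) * n = d := by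
    obtain ⟨k, rfl | rfl⟩ := d.eq_nat_or_neg
    · exact ⟨k * α, k * β, by push_cast; linear_combination (k : ℤ) * h1⟩
    · exact ⟨k * α', k * β', by push_cast; linear_combination (k : ℤ) * h2⟩
  have hsum : ((α : ℤ) + α') * m + ((β : ℤ) + β') * n = 0 := by linear_combination h1 + h2
  -- The term `p + α₀ + β₀` makes the parity equal to that of `p`; the `2` makes `j` positive, so
  -- that the final combination is nonempty.
  have hj : ∃ j : ℕ, 0 < j ∧ (α₀ + β₀ + j) % 2 = p % 2 :=
    ⟨p + α₀ + β₀ + 2, by omega, by omega⟩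
  obtain ⟨j, hj0, hj⟩ := hj
  refine ⟨α₀ + j * (α + α'), β₀ + j * (β + β'), ?_, ?_, ?_⟩
  · push_cast
    linear_combination h0 + (j : ℤ) * hsum
  · have : 0 < j * (α + α' + (β + β')) := Nat.mul_pos hj0 (by omega)
    rw [mul_add] at this
    omega
  · obtain ⟨q, hq⟩ : ∃ q, α + β + (α' + β') = 2 * q + 1 := ⟨(α + β + (α' + β')) / 2, by omega⟩
    have : α₀ + j * (α + α') + (β₀ + j * (β + β')) = α₀ + β₀ + j + 2 * (j * q) := by
      have h3 : j * (α + α') + j * (β + β') = j * (2 * q + 1) := by rw [← hq]; ring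
      linarith
    omega

theorem exists_finset_twoInducedDegree {m n : ℤ} {S : Set ℕ} (hS : S.Infinite)
    (hS' : Sᶜ.Infinite) (htype : IsTypeTwo m n ∨ IsTypeThree m n) (d : ℤ) (p : ℕ)
    (T : Finset ℕ) : ∃ s : Finset ℕ, Disjoint s T ∧ ∑ i ∈ s, twoInducedDegree m n S i = d ∧
      s.Nonempty ∧ s.card % 2 = p % 2 := by
  classical
  obtain ⟨α, β, hd, hpos, hpar⟩ := exists_nat_combination htype d p
  obtain ⟨A, hA, hAc⟩ := (hS.sdiff T.finite_toSet).exists_subset_card_eq α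
  obtain ⟨B, hB, hBc⟩ := (hS'.sdiff T.finite_toSet).exists_subset_card_eq β
  have hAB : Disjoint A B := Finset.disjoint_left.mpr fun i hi hi' => (hB hi').1 (hA hi).1
  have hcard : (A ∪ B).card = α + β := by rw [Finset.card_union_of_disjoint hAB, hAc, hBc]
  refine ⟨A ∪ B, ?_, ?_, ?_, ?_⟩
  · rw [Finset.disjoint_union_left]
    exact ⟨Finset.disjoint_left.mpr fun i hi => (hA hi).2,
      Finset.disjoint_left.mpr fun i hi => (hB hi).2⟩
  · rw [Finset.sum_union hAB,
      Finset.sum_congr rfl (f := twoInducedDegree m n S) (g := fun _ => m)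
        fun i hi => if_pos (hA hi).1,
      Finset.sum_congr rfl (f := twoInducedDegree m n S) (g := fun _ => n)
        fun i hi => if_neg (hB hi).1]
    simp [hAc, hBc, hd]
  · rw [← Finset.card_pos]; omega
  · rw [hcard, hpar]

/-! ### Linear independence of the normal forms on the Grassmann algebra. -/

section Independence

variable {F L : Type*} [Field F] [AddCommGroup L] [Module F L]

/-- In a `2`-induced grading of type (2) or (3), the evaluations of the normal forms
`x_{i_1} ⋯ x_{i_k} [x_{j_1}, x_{j_2}] ⋯` are linearly independent. -/
theorem eq_zero_of_forall_sum_eq_zero [CharZero F] (e : Module.Basis ℕ F L) (m n : ℤ) (S : Set ℕ)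
    (hS : S.Infinite) (hS' : Sᶜ.Infinite) (htype : IsTypeTwo m n ∨ IsTypeThree m n)
    (c : Multiset (ℤ × ℕ) × {J : Finset (ℤ × ℕ) // Even J.card} →₀ F)
    (hc : ∀ y : ℤ × ℕ → ExteriorAlgebra F L, (∀ v, y v ∈ twoInduced e m n S v.1) →
      (c.sum fun p r => r • (orderedMonomial y p.1 * commProd y p.2.1.toList)) = 0) :
    c = 0 := by
  classical
  by_contra hne
  -- Minimality matters first in the commutator part `J₀`, then in the monomial part `a₀` among the
  -- terms with that `J₀`.
  obtain ⟨J₀, hJ₀⟩ :=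
    Finset.exists_minimal ((Finsupp.support_nonempty_iff.mpr hne).image Prod.snd)
  obtain ⟨p₀, hp₀, hp₀'⟩ := Finset.mem_image.mp hJ₀.prop
  have hne' : (c.support.filter (·.2 = J₀)).Nonempty := ⟨p₀, Finset.mem_filter.mpr ⟨hp₀, hp₀'⟩⟩
  obtain ⟨a₀, ha₀⟩ := Finset.exists_minimal (hne'.image Prod.fst)
  have hmem : (a₀, J₀) ∈ c.support := by
    obtain ⟨⟨a, J⟩, hp, rfl⟩ := Finset.mem_image.mp ha₀.prop
    obtain ⟨h1, rfl⟩ := Finset.mem_filter.mp hp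
    exact h1
  -- For each variable `v`, index `(v, 0)` gives an odd monomial and the indices `(v, k + 1)` give
  -- even ones, all of degree `v.1` and pairwise disjoint.
  obtain ⟨g, hgP, hg⟩ := exists_pairwise_disjoint_family (ι := (ℤ × ℕ) × ℕ)
    (fun i s => ∑ j ∈ s, twoInducedDegree m n S j = i.1.1 ∧ s.Nonempty ∧
      s.card % 2 = (if i.2 = 0 then 1 else 0) % 2)
    (fun i T => exists_finset_twoInducedDegree hS hS' htype _ _ T)
  have heven : ∀ v k, Even (g (v, k + 1)).card := fun v k => by
    rw [Nat.even_iff]; simpa using (hgP (v, k + 1)).2.2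
  have hodd : ∀ v, Odd (g (v, 0)).card := fun v => by
    rw [Nat.odd_iff]; simpa using (hgP (v, 0)).2.2
  have hdeg : ∀ v k, e.ExteriorAlgebra (g (v, k)) ∈ twoInduced e m n S v.1 := fun v k =>
    Submodule.subset_span ⟨_, (hgP (v, k)).1, rfl⟩
  let u : ℤ × ℕ → ℕ → Subring.center (ExteriorAlgebra F L) := fun v k =>
    ⟨e.ExteriorAlgebra (g (v, k + 1)), ExteriorAlgebra.basis_mem_center e (heven v k)⟩
  have hu : ∀ v k, u v k * u v k = 0 := fun v k =>
    Subtype.ext (ExteriorAlgebra.basis_mul_self e (hgP (v, k + 1)).2.1)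
  -- Exactly as many summands as the multiplicity of `v` in `a₀`: any higher power of `z v`
  -- vanishes.
  let z : ℤ × ℕ → Subring.center (ExteriorAlgebra F L) := fun v =>
    ∑ k ∈ Finset.range (a₀.count v), u v k
  let θ : ℤ × ℕ → ExteriorAlgebra F L := fun v =>
    if v ∈ J₀.1 then e.ExteriorAlgebra (g (v, 0)) else 0
  have hθ : ∀ v w, θ v * θ w = -(θ w * θ v) := by
    intro v w
    by_cases hv : v ∈ J₀.1 <;> by_cases hw : w ∈ J₀.1 <;> simp only [θ, hv, hw, if_true, if_false,
      mul_zero, zero_mul, neg_zero]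
    exact ExteriorAlgebra.basis_anticomm e (hodd v) (hodd w)
  have hsq : ∀ v, θ v * θ v = 0 := by
    intro v
    by_cases hv : v ∈ J₀.1 <;> simp only [θ, hv, if_true, if_false, mul_zero]
    exact ExteriorAlgebra.basis_mul_self e (hgP (v, 0)).2.1
  have hy : ∀ v, (z v : ExteriorAlgebra F L) + θ v ∈ twoInduced e m n S v.1 := by
    intro v
    refine Submodule.add_mem _ ?_ ?_
    · simp only [z, AddSubmonoidClass.coe_finsetSum]
      exact Submodule.sum_mem _ fun k _ => hdeg v _
    · by_cases hv : v ∈ J₀.1 <;> simp only [θ, hv, if_true, if_false]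
      · exact hdeg v 0
      · exact Submodule.zero_mem _
  set Θ := (J₀.1.toList.map θ).prod with hΘ
  have hθΘ : ∀ v, θ v * Θ = 0 := by
    intro v
    by_cases hv : v ∈ J₀.1
    · exact mul_list_prod_eq_zero_of_mem hθ hsq (Finset.mem_toList.mpr hv)
    · simp only [θ, hv, if_false, zero_mul]
  obtain ⟨k₀, hk₀⟩ := commProd_central_add (z := z) hθ J₀.1.toList
    (by rw [Finset.length_toList]; exact J₀.2)
  have hterm : ∀ a : Multiset (ℤ × ℕ),
      orderedMonomial (fun v => (z v : ExteriorAlgebra F L) + θ v) a *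
        commProd (fun v => (z v : ExteriorAlgebra F L) + θ v) J₀.1.toList =
      2 ^ k₀ * (((a.map z).prod : Subring.center (ExteriorAlgebra F L)) * Θ) := by
    intro a
    have h2 : ∀ w : ExteriorAlgebra F L, Commute w (2 ^ k₀) := fun w =>
      (Commute.ofNat_right _ 2).pow_right k₀
    rw [hk₀, ← mul_assoc, (h2 _).eq, mul_assoc, orderedMonomial_central_add_mul hθΘ]
  have hsum := hc _ hy
  rw [Finsupp.sum, Finset.sum_eq_single (a₀, J₀)] at hsum
  rotate_left
  · rintro ⟨a, J⟩ hp hpne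
    -- If `J ⊄ J₀`, some commutator entry has `θ v = 0`. Otherwise `J = J₀` by minimality, `a ≰ a₀`,
    -- and some `z v` occurs to too high a power.
    by_cases hJ : J ≤ J₀
    · obtain rfl : J = J₀ :=
        le_antisymm hJ (hJ₀.le_of_le (Finset.mem_image.mpr ⟨_, hp, rfl⟩) hJ)
      have hle : ¬ a ≤ a₀ := fun hle => hpne <| by
        rw [le_antisymm hle (ha₀.le_of_le
          (Finset.mem_image.mpr ⟨_, Finset.mem_filter.mpr ⟨hp, rfl⟩, rfl⟩) hle)]
      rw [Multiset.le_iff_count] at hle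
      push Not at hle
      obtain ⟨v, hv⟩ := hle
      have hz : (a.map z).prod = 0 := by
        rw [Finset.prod_multiset_map_count]
        refine Finset.prod_eq_zero (i := v) ?_ ?_
        · rw [Multiset.mem_toFinset, ← Multiset.count_pos]; omega
        · exact pow_eq_zero_of_le hv (sum_range_pow_of_mul_self_eq_zero (hu v) _).1
      rw [hterm, hz, ZeroMemClass.coe_zero, zero_mul, mul_zero, smul_zero]
    · obtain ⟨v, hv, hv'⟩ := Finset.not_subset.mp hJ
      obtain ⟨k, hk⟩ := commProd_central_add (z := z) hθ J.1.toList
        (by rw [Finset.length_toList]; exact J.2)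
      have h0 : (J.1.toList.map θ).prod = 0 := List.prod_eq_zero <|
        List.mem_map.mpr ⟨v, Finset.mem_toList.mpr hv, by simp only [θ, hv', if_false]⟩
      simp only [hk, h0, mul_zero, smul_zero]
  · exact fun h => (h hmem).elim
  rw [hterm] at hsum
  let K : Finset (Σ _ : ℤ × ℕ, ℕ) := a₀.toFinset.sigma fun v => Finset.range (a₀.count v)
  have hz : (a₀.map z).prod = (∏ v ∈ a₀.toFinset, (a₀.count v).factorial : ℕ) *
      ∏ p ∈ K, u p.1 p.2 := by
    rw [Finset.prod_multiset_map_count, Finset.prod_sigma, Nat.cast_prod, ← Finset.prod_mul_distrib]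
    exact Finset.prod_congr rfl fun v _ => (sum_range_pow_of_mul_self_eq_zero (hu v) _).2
  let l : List ((ℤ × ℕ) × ℕ) := K.toList.map (fun p => (p.1, p.2 + 1)) ++
    J₀.1.toList.map fun v => (v, 0)
  have hl : l.Nodup := by
    refine List.nodup_append.mpr ⟨K.nodup_toList.map ?_, J₀.1.nodup_toList.map ?_, ?_⟩
    · rintro ⟨v, k⟩ ⟨w, k'⟩ h
      simp only [Prod.mk.injEq, Nat.add_right_cancel_iff] at h
      rw [h.1, h.2]
    · exact fun v w h => (Prod.mk.inj h).1
    · intro p hp q hq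
      obtain ⟨_, _, rfl⟩ := List.mem_map.mp hp
      obtain ⟨_, _, rfl⟩ := List.mem_map.mp hq
      simp
  have hprod : ((∏ p ∈ K, u p.1 p.2 : Subring.center (ExteriorAlgebra F L)) :
      ExteriorAlgebra F L) * Θ = ((l.map g).map e.ExteriorAlgebra).prod := by
    have h1 : ((∏ p ∈ K, u p.1 p.2 : Subring.center (ExteriorAlgebra F L)) :
        ExteriorAlgebra F L) =
        (K.toList.map fun p => e.ExteriorAlgebra (g (p.1, p.2 + 1))).prod := by
      rw [← Finset.prod_map_toList, ← Subring.subtype_apply, map_list_prod, List.map_map]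
      rfl
    have h2 : Θ = (J₀.1.toList.map fun v => e.ExteriorAlgebra (g (v, 0))).prod := by
      rw [hΘ]
      congr 1
      exact List.map_congr_left fun v hv => if_pos (Finset.mem_toList.mp hv)
    rw [h1, h2]
    simp only [l, List.map_append, List.map_map, List.prod_append]
    rfl
  -- The surviving term is a product of monomials with disjoint supports, hence plus or minus a
  -- basis element.
  have hne0 := ExteriorAlgebra.basis_list_prod_ne_zero e (l.map g)
    (List.pairwise_map.mpr (hl.imp fun h => hg h))
  rw [← hprod] at hne0
  rw [hz, Subring.coe_mul, mul_assoc, SubringClass.coe_natCast,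
    show (2 : ExteriorAlgebra F L) ^ k₀ = ((2 ^ k₀ : ℕ) : ExteriorAlgebra F L) by push_cast; rfl,
    ← nsmul_eq_mul, ← nsmul_eq_mul, smul_smul, ← Nat.cast_smul_eq_nsmul F, smul_smul,
    smul_eq_zero] at hsum
  refine hsum.elim (mul_ne_zero (Finsupp.mem_support_iff.mp hmem) (Nat.cast_ne_zero.mpr ?_)) hne0
  exact mul_ne_zero (pow_ne_zero _ two_ne_zero)
    (Finset.prod_ne_zero_iff.mpr fun v _ => Nat.factorial_ne_zero _)

end Independence

/-! ### The `T_ℤ`-ideal of `𝔙₁` -/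

section TIdeal

variable {F : Type*} [Field F]

theorem gradedVar_mem_freeComponent (v : ℤ × ℕ) : FreeAlgebra.ι F v ∈ freeComponent F v.1 :=
  Submodule.subset_span ⟨[v], by simp, by simp [gradedVar]⟩

theorem freeComponent_gradedMonoid : SetLike.GradedMonoid (freeComponent F) where
  one_mem := Submodule.subset_span ⟨[], by simp, by simp⟩
  mul_mem := by
    intro i j p q hp hq
    have h : p * q ∈ freeComponent F i * freeComponent F j := Submodule.mul_mem_mul hp hq
    rw [freeComponent, freeComponent, Submodule.span_mul_span] at h
    refine Submodule.span_mono ?_ h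
    rintro _ ⟨_, ⟨w, rfl, rfl⟩, _, ⟨w', rfl, rfl⟩, rfl⟩
    exact ⟨w ++ w', by simp, by simp⟩

theorem lift_mem_of_mem_freeComponent {A : Type*} [Ring A] [Algebra F A]
    {𝒜 : ℤ → Submodule F A} [SetLike.GradedMonoid 𝒜] {a : ℤ × ℕ → A} (ha : ∀ v, a v ∈ 𝒜 v.1)
    {d : ℤ} {p : FreeGraded F} (hp : p ∈ freeComponent F d) : FreeAlgebra.lift F a p ∈ 𝒜 d := by
  induction hp using Submodule.span_induction with
  | mem p hp =>
    obtain ⟨w, rfl, rfl⟩ := hp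
    rw [map_list_prod, List.map_map]
    refine SetLike.list_prod_map_mem_graded w _ _ fun v _ => ?_
    simpa [gradedVar] using ha v
  | zero => rw [map_zero]; exact Submodule.zero_mem _
  | add p q _ _ hp hq => rw [map_add]; exact Submodule.add_mem _ hp hq
  | smul c p _ hp => rw [map_smul]; exact Submodule.smul_mem _ _ hp

theorem mem_gradedIdentities {A : Type*} [Ring A] [Algebra F A] {𝒜 : ℤ → Submodule F A}
    [GradedAlgebra 𝒜] {p : FreeGraded F} : p ∈ gradedIdentities 𝒜 ↔
      ∀ a : ℤ × ℕ → A, (∀ v, a v ∈ 𝒜 v.1) → FreeAlgebra.lift F a p = 0 :=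
  TwoSidedIdeal.mem_mk' ..

theorem isTIdeal_gradedIdentities {A : Type*} [Ring A] [Algebra F A] (𝒜 : ℤ → Submodule F A)
    [GradedAlgebra 𝒜] : IsTIdeal (gradedIdentities 𝒜) := by
  intro φ hφ p hp
  rw [mem_gradedIdentities] at hp ⊢
  intro a ha
  have h : (FreeAlgebra.lift F a).comp φ =
      FreeAlgebra.lift F fun v => FreeAlgebra.lift F a (φ (FreeAlgebra.ι F v)) := by
    ext v; simp
  rw [← AlgHom.comp_apply, h]
  exact hp _ fun v => lift_mem_of_mem_freeComponent ha (hφ _ _ (gradedVar_mem_freeComponent v))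

theorem varietyOne_tIdeal_le_gradedIdentities {A : Type*} [Ring A] [Algebra F A]
    (𝒜 : ℤ → Submodule F A) [GradedAlgebra 𝒜] (hA : HasCentralCommutators A) :
    (varietyOne F).tIdeal ≤ gradedIdentities 𝒜 := by
  refine sInf_le ⟨isTIdeal_gradedIdentities 𝒜, ?_⟩
  rintro _ ⟨a, b, c, rfl⟩
  refine mem_gradedIdentities.mpr fun y _ => ?_
  simpa only [Ring.lie_def, map_sub, map_mul] using hA _ _ _

theorem lie_lie_mem_of_mem_freeComponent {d₁ d₂ d₃ : ℤ} {p q r : FreeGraded F}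
    (hp : p ∈ freeComponent F d₁) (hq : q ∈ freeComponent F d₂) (hr : r ∈ freeComponent F d₃) :
    ⁅⁅p, q⁆, r⁆ ∈ (varietyOne F).tIdeal := by
  classical
  -- The indices `1`, `2`, `3` keep the three variables distinct even when their degrees coincide.
  let a : ℤ × ℕ → FreeGraded F := fun v =>
    if v = (d₁, 1) then p else if v = (d₂, 2) then q else if v = (d₃, 3) then r
    else FreeAlgebra.ι F v
  have ha : ∀ v, a v ∈ freeComponent F v.1 := by
    intro v
    simp only [a]
    split_ifs with h1 h2 h3
    · rwa [h1]
    · rwa [h2]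
    · rwa [h3]
    · exact gradedVar_mem_freeComponent v
  have := freeComponent_gradedMonoid (F := F)
  have hgen : ⁅⁅gradedVar F d₁ 1, gradedVar F d₂ 2⁆, gradedVar F d₃ 3⁆ ∈
      (varietyOne F).tIdeal :=
    by
    change _ ∈ tIdealSpan _
    rw [tIdealSpan, TwoSidedIdeal.mem_sInf]
    exact fun I hI => hI.2 ⟨d₁, d₂, d₃, rfl⟩
  have h := (varietyOne F).isTIdeal (FreeAlgebra.lift F a)
    (fun d p hp => lift_mem_of_mem_freeComponent ha hp) _ hgen
  simpa [Ring.lie_def, gradedVar, a] using h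

theorem span_words_eq_top : Submodule.span F
    (Set.range fun w : List (ℤ × ℕ) => (w.map (FreeAlgebra.ι F)).prod) = ⊤ := by
  refine Submodule.eq_top_iff'.mpr fun p => ?_
  induction p using FreeAlgebra.induction with
  | grade0 r =>
    rw [Algebra.algebraMap_eq_smul_one]
    exact Submodule.smul_mem _ _ (Submodule.subset_span ⟨[], by simp⟩)
  | grade1 v => exact Submodule.subset_span ⟨[v], by simp⟩
  | mul p q hp hq =>
    have h := Submodule.mul_mem_mul hp hq
    rw [Submodule.span_mul_span] at h
    refine Submodule.span_mono ?_ h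
    rintro _ ⟨_, ⟨w, rfl⟩, _, ⟨w', rfl⟩, rfl⟩
    exact ⟨w ++ w', by simp⟩
  | add p q hp hq => exact Submodule.add_mem _ hp hq

theorem word_mem_freeComponent (w : List (ℤ × ℕ)) :
    (w.map (FreeAlgebra.ι F)).prod ∈ freeComponent F (w.map Prod.fst).sum :=
  Submodule.subset_span ⟨w, rfl, rfl⟩

theorem smul_mem_twoSidedIdeal {A : Type*} [Ring A] [Algebra F A] (I : TwoSidedIdeal A) (c : F)
    {p : A} (hp : p ∈ I) : c • p ∈ I := by
  rw [Algebra.smul_def]; exact I.mul_mem_left _ _ hp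

section

variable {A : Type*} [Ring A] [Algebra F A] (c : F) (p p' q : A)

theorem commutator_add_left : ⁅p + p', q⁆ = ⁅p, q⁆ + ⁅p', q⁆ := by
  simp only [Ring.lie_def]; noncomm_ring

theorem commutator_add_right : ⁅q, p + p'⁆ = ⁅q, p⁆ + ⁅q, p'⁆ := by
  simp only [Ring.lie_def]; noncomm_ring

theorem commutator_smul_left : ⁅c • p, q⁆ = c • ⁅p, q⁆ := by
  rw [Ring.lie_def, Ring.lie_def, smul_mul_assoc, mul_smul_comm, smul_sub]

theorem commutator_smul_right : ⁅q, c • p⁆ = c • ⁅q, p⁆ := by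
  rw [Ring.lie_def, Ring.lie_def, smul_mul_assoc, mul_smul_comm, smul_sub]

end

/-- The double commutator is trilinear and words are homogeneous, so the homogeneous case suffices.
-/
theorem lie_lie_mem_varietyOne (p q r : FreeGraded F) :
    ⁅⁅p, q⁆, r⁆ ∈ (varietyOne F).tIdeal := by
  have ht : ∀ p : FreeGraded F, p ∈ Submodule.span F
      (Set.range fun w : List (ℤ × ℕ) => (w.map (FreeAlgebra.ι F)).prod) := fun p => by
    rw [span_words_eq_top]; trivial
  induction ht p using Submodule.span_induction with
  | zero => simp [Ring.lie_def]
  | add p p' _ _ hp hp' => rw [commutator_add_left, commutator_add_left]; exact add_mem hp hp'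
  | smul c p _ hp =>
    rw [commutator_smul_left, commutator_smul_left]; exact smul_mem_twoSidedIdeal _ c hp
  | mem p hp =>
    obtain ⟨w₁, rfl⟩ := hp
    induction ht q using Submodule.span_induction with
    | zero => simp [Ring.lie_def]
    | add p p' _ _ hp hp' => rw [commutator_add_right, commutator_add_left]; exact add_mem hp hp'
    | smul c p _ hp =>
      rw [commutator_smul_right, commutator_smul_left]; exact smul_mem_twoSidedIdeal _ c hp
    | mem q hq =>
      obtain ⟨w₂, rfl⟩ := hq
      induction ht r using Submodule.span_induction with
      | zero => simp [Ring.lie_def]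
      | add p p' _ _ hp hp' => rw [commutator_add_right]; exact add_mem hp hp'
      | smul c p _ hp => rw [commutator_smul_right]; exact smul_mem_twoSidedIdeal _ c hp
      | mem r hr =>
        obtain ⟨w₃, rfl⟩ := hr
        exact lie_lie_mem_of_mem_freeComponent (word_mem_freeComponent w₁)
          (word_mem_freeComponent w₂) (word_mem_freeComponent w₃)

/-- Modulo the `T_ℤ`-ideal of `𝔙₁`, every polynomial is a combination of normal forms. -/
theorem exists_normalForm (f : FreeGraded F) :
    ∃ c : Multiset (ℤ × ℕ) × {J : Finset (ℤ × ℕ) // Even J.card} →₀ F,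
      f - (c.sum fun p r => r • (orderedMonomial (FreeAlgebra.ι F) p.1 *
        commProd (FreeAlgebra.ι F) p.2.1.toList)) ∈ (varietyOne F).tIdeal := by
  classical
  let π := RingCon.mkₐ F (varietyOne F).tIdeal.ringCon
  have hπ : ∀ p q : FreeGraded F, π p = π q ↔ p - q ∈ (varietyOne F).tIdeal := fun p q =>
    (RingCon.eq _).trans (TwoSidedIdeal.rel_iff _ _ _)
  have hsurj : Function.Surjective π := Quotient.mk''_surjective
  have hQ : HasCentralCommutators (varietyOne F).tIdeal.ringCon.Quotient := by
    intro p q r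
    obtain ⟨p, rfl⟩ := hsurj p
    obtain ⟨q, rfl⟩ := hsurj q
    obtain ⟨r, rfl⟩ := hsurj r
    have h := (hπ _ 0).mpr (by rw [sub_zero]; exact lie_lie_mem_varietyOne p q r)
    simpa only [Ring.lie_def, map_sub, map_mul, map_zero] using h
  have hmem : π f ∈ Submodule.span F
      (Set.range fun p : Multiset (ℤ × ℕ) × {J : Finset (ℤ × ℕ) // Even J.card} =>
        orderedMonomial (fun v => π (FreeAlgebra.ι F v)) p.1 *
          commProd (fun v => π (FreeAlgebra.ι F v)) p.2.1.toList) := by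
    have hf : f ∈ Submodule.span F
        (Set.range fun w : List (ℤ × ℕ) => (w.map (FreeAlgebra.ι F)).prod) := by
      rw [span_words_eq_top]; trivial
    induction hf using Submodule.span_induction with
    | zero => rw [map_zero]; exact Submodule.zero_mem _
    | add p q _ _ hp hq => rw [map_add]; exact Submodule.add_mem _ hp hq
    | smul c p _ hp => rw [map_smul]; exact Submodule.smul_mem _ _ hp
    | mem p hp =>
      obtain ⟨w, rfl⟩ := hp
      have h := word_mul_commProd_mem_span (fun v => π (FreeAlgebra.ι F v)) hQ F w.length w [] rfl
      simpa only [commProd, mul_one, map_list_prod, List.map_map, Function.comp_def] using h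
  obtain ⟨c, hc⟩ := Finsupp.mem_span_range_iff_exists_finsupp.mp hmem
  refine ⟨c, (hπ _ _).mp ?_⟩
  rw [← hc, Finsupp.sum, Finsupp.sum, map_sum]
  refine Finset.sum_congr rfl fun p _ => ?_
  rw [map_smul, map_mul]
  exact congrArg _ (congrArg₂ _ (map_orderedMonomial _ π.toRingHom _).symm
    (map_commProd _ π.toRingHom _).symm)

end TIdeal

theorem proposition3p9 {F L : Type*} [Field F] [CharZero F] [AddCommGroup L] [Module F L]
    (e : Module.Basis ℕ F L) (m n : ℤ) (hmn : m < n)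
    (S : Set ℕ) (hS : S.Infinite) (hS' : Sᶜ.Infinite)
    (hfull : gradingSupport (twoInduced e m n S) = Set.univ)
    (htype : IsTypeTwo m n ∨ IsTypeThree m n) :
    (varietyOne F).IsGeneratedBy (twoInduced e m n S) := by
  have hle := varietyOne_tIdeal_le_gradedIdentities (twoInduced e m n S)
    (ExteriorAlgebra.hasCentralCommutators e)
  refine le_antisymm hle fun f hf => ?_
  obtain ⟨c, hc⟩ := exists_normalForm f
  -- The normal form of `f` is itself a graded identity, so independence forces its coefficients to
  -- vanish.
  have hg := sub_mem hf (hle hc)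
  rw [sub_sub_cancel, mem_gradedIdentities] at hg
  have hc0 : c = 0 := by
    refine eq_zero_of_forall_sum_eq_zero e m n S hS hS' htype c fun y hy => ?_
    rw [← hg y hy, Finsupp.sum, Finsupp.sum, map_sum]
    refine Finset.sum_congr rfl fun p _ => ?_
    have h1 := map_orderedMonomial (FreeAlgebra.ι F) (FreeAlgebra.lift F y).toRingHom p.1
    have h2 := map_commProd (FreeAlgebra.ι F) (FreeAlgebra.lift F y).toRingHom p.2.1.toList
    simp only [AlgHom.toRingHom_eq_coe, RingHom.coe_coe, FreeAlgebra.lift_ι_apply] at h1 h2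
    rw [map_smul, map_mul, h1, h2]
  simpa [hc0] using hc
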